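/- Let $k,n\ge 2$ be integers, and view families $p=(p(a,b|x,y))_{x,y\in[k],\,a,b\in[n]}$ of real numbers as points of $\mathbb R^{k^2n^2}$. A POVM of length $n$ on a Hilbert space $H$ is a tuple $(A_1,\dots,A_n)$ of positive operators on $H$ with $\sum_a A_a=I$. Let $C_q(k,n)\subseteq[0,1]^{k^2n^2}$ be the set of all $p$ of the form $p(a,b|x,y)=\langle (A^x_a\otimes B^y_b)\xi,\xi\rangle$, where $H_A,H_B$ are finite-dimensional complex Hilbert spaces, $A^x=(A^x_1,\dots,A^x_n)$ ($x\in[k]$) are POVMs on $H_A$, $B^y=(B^y_1,\dots,B^y_n)$ ($y\in[k]$) are POVMs on $H_B$, and $\xi\in H_A\otimes H_B$ is a unit vector. Let $C_q^s(k,n)$ be the set of synchronous elements of $C_q(k,n)$, i.e. those with $p(a,b|x,x)=0$ for all $x\in[k]$ and all distinct $a,b\in[n]$. Let $\mathcal R$ be the hyperfinite II$_1$ factor with its trace $\tau_{\mathcal R}$, realized as the direct limit, in the category of tracial von Neumann algebras, of the matrix algebras $M_{2^m}(\mathbb C)$ (with normalized traces) along the maps $A\mapsto\begin{pmatrix}A&0\\0&A\end{pmatrix}$;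 that is, $\mathcal R$ is the von Neumann algebra generated by the $*$-algebra $\varinjlim M_{2^m}(\mathbb C)$ in its GNS representation with respect to its trace, and $\tau_{\mathcal R}$ is the vector state given by the class of $1$. A PVM of length $n$ in $\mathcal R$ is a tuple $(e_1,\dots,e_n)$ of projections ($e_a^*=e_a=e_a^2$) in $\mathcal R$ with $\sum_a e_a=1$. Let $C_{\mathcal R}(k,n)$ be the set of all $p\in[0,1]^{k^2n^2}$ for which there are PVMs $e^1,\dots,e^k$ of length $n$ in $\mathcal R$ such that $p(a,b|x,y)=\tau_{\mathcal R}(e^x_ae^y_b)$ for all $x,y\in[k]$ and $a,b\in[n]$. Then $\overline{C_q^s(k,n)}=\overline{C_{\mathcal R}(k,n)}$. -/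

import Mathlib

open scoped Kronecker TensorProduct

noncomputable section

/-! ### Quantum correlations -/

/-- The space of arrays `p(a,b|x,y)`, with `p x y a b` standing for `p(a,b|x,y)`; questions `x, y`
range over `Fin k` and answers `a, b` over `Fin n`. It carries the product topology. -/
abbrev Corr (k n : ℕ) : Type := Fin k → Fin k → Fin n → Fin n → ℝ

/-- The tuple `A` of operators on the Hilbert space `H` is a positive operator valued measure. -/
def IsPOVM {H : Type*} [NormedAddCommGroup H] [InnerProductSpace ℂ H] {n : ℕ}
    (A : Fin n → (H →ₗ[ℂ] H)) : Prop :=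
  (∀ a, (A a).IsPositive) ∧ ∑ a, A a = 1

/-- The set of quantum correlations with `k` questions and `n` answers. -/
def quantumCorr (k n : ℕ) : Set (Corr k n) :=
  {p | ∃ (HA HB : Type) (_ : NormedAddCommGroup HA) (_ : InnerProductSpace ℂ HA)
      (_ : FiniteDimensional ℂ HA) (_ : NormedAddCommGroup HB) (_ : InnerProductSpace ℂ HB)
      (_ : FiniteDimensional ℂ HB)
      (A : Fin k → Fin n → (HA →ₗ[ℂ] HA)) (B : Fin k → Fin n → (HB →ₗ[ℂ] HB))
      (ξ : HA ⊗[ℂ] HB),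
      (∀ x, IsPOVM (A x)) ∧ (∀ y, IsPOVM (B y)) ∧ ‖ξ‖ = 1 ∧
      ∀ x y a b, (p x y a b : ℂ) = inner ℂ ξ (TensorProduct.map (A x a) (B y b) ξ)}

/-- A correlation is synchronous if different answers to the same question have probability `0`. -/
def IsSynchronous {k n : ℕ} (p : Corr k n) : Prop :=
  ∀ x a b, a ≠ b → p x x a b = 0

/-- The set of synchronous quantum correlations. -/
def syncQuantumCorr (k n : ℕ) : Set (Corr k n) :=
  {p | p ∈ quantumCorr k n ∧ IsSynchronous p}

/-! ### The direct limit of the matrix algebras of size `2 ^ n` -/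

/-- The algebra of complex matrices of size `2 ^ n`. -/
abbrev DyadicMatrix (n : ℕ) : Type := Matrix (Fin (2 ^ n)) (Fin (2 ^ n)) ℂ

/-- The identification of `Fin (2 ^ (j - i)) × Fin (2 ^ i)` with `Fin (2 ^ j)` that sends
`(c, r)` to `r + 2 ^ i * c`. -/
def dyadicEquiv {i j : ℕ} (h : i ≤ j) : Fin (2 ^ (j - i)) × Fin (2 ^ i) ≃ Fin (2 ^ j) :=
  finProdFinEquiv.trans (finCongr (by rw [← pow_add, Nat.sub_add_cancel h]))

/-- The bonding maps: `A` is sent to the block diagonal matrix `diag(A, …, A)` consisting of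
`2 ^ (j - i)` copies of `A`. -/
def dyadicBond (i j : ℕ) (h : i ≤ j) : DyadicMatrix i →⋆ₐ[ℂ] DyadicMatrix j where
  toFun A := Matrix.reindex (dyadicEquiv h) (dyadicEquiv h)
    ((1 : Matrix (Fin (2 ^ (j - i))) (Fin (2 ^ (j - i))) ℂ) ⊗ₖ A)
  map_one' := by simp
  map_mul' A B := by
    rw [← one_mul (1 : Matrix (Fin (2 ^ (j - i))) (Fin (2 ^ (j - i))) ℂ),
      Matrix.mul_kronecker_mul]
    simp [Matrix.submatrix_mul_equiv]
  map_zero' := by simp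
  map_add' A B := by
    rw [Matrix.kronecker_add]
    rfl
  commutes' r := by
    simp [Algebra.algebraMap_eq_smul_one, Matrix.kronecker_smul, Matrix.submatrix_smul]
  map_star' A := by
    simp [Matrix.star_eq_conjTranspose, Matrix.conjTranspose_kronecker]

theorem dyadicBond_apply {i j : ℕ} (h : i ≤ j) (A : DyadicMatrix i) (r s : Fin (2 ^ j)) :
    dyadicBond i j h A r s =
      if (r : ℕ) / 2 ^ i = (s : ℕ) / 2 ^ i then
        A ⟨r % 2 ^ i, Nat.mod_lt _ (by positivity)⟩ ⟨s % 2 ^ i, Nat.mod_lt _ (by positivity)⟩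
      else 0 := by
  simp only [dyadicBond, StarAlgHom.coe_mk', AlgHom.coe_mk, RingHom.coe_mk, MonoidHom.coe_mk,
    OneHom.coe_mk, Matrix.reindex_apply, Matrix.submatrix_apply, Matrix.kroneckerMap_apply,
    Matrix.one_apply, dyadicEquiv]
  simp [Fin.ext_iff, Fin.divNat, Fin.modNat]

/-- The normalized trace on matrices of size `2 ^ n`. -/
def dyadicTrace (n : ℕ) : DyadicMatrix n →ₗ[ℂ] ℂ :=
  ((2 : ℂ) ^ n)⁻¹ • Matrix.traceLinearMap (Fin (2 ^ n)) ℂ ℂ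

theorem dyadicTrace_bond (i j : ℕ) (h : i ≤ j) (A : DyadicMatrix i) :
    dyadicTrace j (dyadicBond i j h A) = dyadicTrace i A := by
  have : Matrix.trace (dyadicBond i j h A) = 2 ^ (j - i) * Matrix.trace A := by
    have h2 := Matrix.trace_kronecker
      (1 : Matrix (Fin (2 ^ (j - i))) (Fin (2 ^ (j - i))) ℂ) A
    simp only [Matrix.trace_one, Fintype.card_fin, Nat.cast_pow, Nat.cast_ofNat] at h2
    rw [← h2]
    exact Equiv.sum_comp (dyadicEquiv h).symm
      (fun u => ((1 : Matrix (Fin (2 ^ (j - i))) (Fin (2 ^ (j - i))) ℂ) ⊗ₖ A) u u)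
  simp only [dyadicTrace, LinearMap.smul_apply, Matrix.traceLinearMap_apply, this, smul_eq_mul]
  obtain ⟨d, rfl⟩ := Nat.exists_eq_add_of_le h
  rw [Nat.add_sub_cancel_left, pow_add]
  field_simp

instance dyadicBond_directedSystem :
    DirectedSystem DyadicMatrix (fun i j h => (dyadicBond i j h : DyadicMatrix i → DyadicMatrix j))
    where
  map_self i A := by
    ext r s
    have hr : (r : ℕ) / 2 ^ i = 0 := Nat.div_eq_of_lt r.2
    have hs : (s : ℕ) / 2 ^ i = 0 := Nat.div_eq_of_lt s.2
    simp [dyadicBond_apply, hr, hs, Nat.mod_eq_of_lt r.2, Nat.mod_eq_of_lt s.2]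
  map_map k j i hij hjk A := by
    ext r s
    have hdvd : 2 ^ i ∣ 2 ^ j := pow_dvd_pow 2 hij
    have hpow : 2 ^ j = 2 ^ i * 2 ^ (j - i) := by rw [← pow_add, Nat.add_sub_cancel' hij]
    have hiff : ∀ t u : ℕ, t / 2 ^ i = u / 2 ^ i ↔
        t / 2 ^ j = u / 2 ^ j ∧ t % 2 ^ j / 2 ^ i = u % 2 ^ j / 2 ^ i := by
      intro t u
      rw [hpow, ← Nat.div_div_eq_div_mul, ← Nat.div_div_eq_div_mul, Nat.mod_mul_right_div_self,
        Nat.mod_mul_right_div_self]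
      refine ⟨fun h => by rw [h]; exact ⟨rfl, rfl⟩, fun h => ?_⟩
      rw [← Nat.div_add_mod (t / 2 ^ i) (2 ^ (j - i)), h.1, h.2, Nat.div_add_mod]
    simp only [dyadicBond_apply, Nat.mod_mod_of_dvd _ hdvd, hiff r s, ite_and]

/-- The direct limit of the matrix algebras `M_{2 ^ n}(ℂ)` along the maps `A ↦ diag(A, A)`, as a
`*`-algebra. -/
def DyadicAlg : Type := DirectLimit DyadicMatrix dyadicBond

namespace DyadicAlg

instance : Ring DyadicAlg := inferInstanceAs (Ring (DirectLimit DyadicMatrix dyadicBond))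

instance : Algebra ℂ DyadicAlg :=
  inferInstanceAs (Algebra ℂ (DirectLimit DyadicMatrix dyadicBond))

instance : StarMul DyadicAlg := inferInstanceAs (StarMul (DirectLimit DyadicMatrix dyadicBond))

instance : StarRing DyadicAlg where
  star_add := (inferInstance : StarAddMonoid (DirectLimit DyadicMatrix dyadicBond)).star_add

instance : StarModule ℂ DyadicAlg where
  star_smul := (inferInstance : StarModule ℂ (DirectLimit DyadicMatrix dyadicBond)).star_smul

/-- The canonical map from the matrices of size `2 ^ n` to the direct limit. -/
def of (n : ℕ) : DyadicMatrix n →⋆ₐ[ℂ] DyadicAlg where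
  __ := DirectLimit.Algebra.of DyadicMatrix dyadicBond n
  map_star' _ := rfl

theorem of_bond (i j : ℕ) (h : i ≤ j) (A : DyadicMatrix i) : of j (dyadicBond i j h A) = of i A :=
  DirectLimit.Algebra.of_f h A

theorem exists_of (a : DyadicAlg) : ∃ n A, a = of n A := DirectLimit.exists_eq_mk _ a

/-- The tracial state on the direct limit induced by the normalized traces. -/
def trace : DyadicAlg →ₗ[ℂ] ℂ :=
  DirectLimit.Module.lift ℂ ℕ DyadicMatrix dyadicBond dyadicTrace dyadicTrace_bond

theorem trace_of (n : ℕ) (A : DyadicMatrix n) : trace (of n A) = dyadicTrace n A := rfl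

open scoped ComplexOrder in
theorem trace_star_mul_self_nonneg (a : DyadicAlg) : 0 ≤ trace (star a * a) := by
  obtain ⟨n, A, rfl⟩ := exists_of a
  rw [← map_star, ← map_mul, trace_of]
  have := (Matrix.posSemidef_conjTranspose_mul_self A).trace_nonneg
  exact mul_nonneg (by positivity) this

theorem trace_star (a : DyadicAlg) : trace (star a) = star (trace a) := by
  obtain ⟨n, A, rfl⟩ := exists_of a
  rw [← map_star, trace_of, trace_of]
  simp [dyadicTrace, Matrix.star_eq_conjTranspose, Matrix.trace_conjTranspose]

theorem trace_mul_comm (a b : DyadicAlg) : trace (a * b) = trace (b * a) := by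
  obtain ⟨n, A, rfl⟩ := exists_of a
  obtain ⟨m, B, rfl⟩ := exists_of b
  rw [← of_bond n (max n m) (le_max_left _ _), ← of_bond m (max n m) (le_max_right _ _),
    ← map_mul, ← map_mul, trace_of, trace_of]
  simp [dyadicTrace, Matrix.trace_mul_comm (dyadicBond n _ _ A)]

open scoped ComplexOrder in
theorem eq_zero_of_trace (a : DyadicAlg) (h : trace (star a * a) = 0) : a = 0 := by
  obtain ⟨n, A, rfl⟩ := exists_of a
  rw [← map_star, ← map_mul, trace_of] at h
  have : (A.conjTranspose * A).trace = 0 := by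
    simpa [dyadicTrace, Matrix.star_eq_conjTranspose] using h
  rw [Matrix.trace_conjTranspose_mul_self_eq_zero_iff.1 this, map_zero]

/-- The inner product `⟨a, b⟩ = τ(a* b)` on the direct limit. -/
abbrev innerCore : InnerProductSpace.Core ℂ DyadicAlg where
  inner a b := trace (star a * b)
  conj_inner_symm a b := by
    rw [starRingEnd_apply, ← trace_star, star_mul, star_star]
  re_inner_nonneg a := (Complex.nonneg_iff.1 (trace_star_mul_self_nonneg a)).1
  add_left a b c := by rw [star_add, add_mul, map_add]
  smul_left a b r := by simp
  definite a := eq_zero_of_trace a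

/-- The norm on the direct limit is the 2-norm `‖a‖ = τ(a* a) ^ (1 / 2)`. -/
instance : NormedAddCommGroup DyadicAlg :=
  InnerProductSpace.Core.toNormedAddCommGroup (cd := innerCore)

instance : InnerProductSpace ℂ DyadicAlg := InnerProductSpace.ofCore innerCore.toCore

theorem inner_def (a b : DyadicAlg) : inner ℂ a b = trace (star a * b) := rfl

theorem norm_mul_le_of_partialIsometry (v : DyadicAlg)
    (hv : star v * v * (star v * v) = star v * v) (b : DyadicAlg) : ‖v * b‖ ≤ ‖b‖ := by
  rw [← sq_le_sq₀ (norm_nonneg _) (norm_nonneg _), ← inner_self_eq_norm_sq (𝕜 := ℂ),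
    ← inner_self_eq_norm_sq (𝕜 := ℂ), inner_def, inner_def, ← sub_nonneg, ← map_sub, ← map_sub]
  have h : star b * b - star (v * b) * (v * b) =
      star (b - star v * v * b) * (b - star v * v * b) := by
    have h2 : star b * (star v * v * (star v * v)) * b = star b * (star v * v) * b := by rw [hv]
    simp only [star_sub, star_mul, star_star, sub_mul, mul_sub, ← mul_assoc] at h2 ⊢
    rw [h2]
    abel
  rw [h]
  exact innerCore.re_inner_nonneg (b - star v * v * b)

theorem exists_norm_mul_le (a : DyadicAlg) : ∃ C : ℝ, ∀ b : DyadicAlg, ‖a * b‖ ≤ C * ‖b‖ := by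
  obtain ⟨n, A, rfl⟩ := exists_of a
  induction A using Matrix.induction_on' with
  | h_zero => exact ⟨0, fun b => by simp⟩
  | h_add p q hp hq =>
    obtain ⟨C, hC⟩ := hp
    obtain ⟨D, hD⟩ := hq
    refine ⟨C + D, fun b => ?_⟩
    rw [map_add, add_mul, add_mul]
    exact (norm_add_le _ _).trans (add_le_add (hC b) (hD b))
  | h_std_basis i j c =>
    refine ⟨‖c‖, fun b => ?_⟩
    have h : Matrix.single i j c = c • Matrix.single i j (1 : ℂ) := by simp
    rw [h, map_smul, smul_mul_assoc, norm_smul]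
    gcongr
    refine norm_mul_le_of_partialIsometry _ ?_ b
    simp only [← map_star, ← map_mul, Matrix.star_eq_conjTranspose]
    simp

/-- Left multiplication by `a`, as a bounded operator for the 2-norm. -/
def leftMul (a : DyadicAlg) : DyadicAlg →L[ℂ] DyadicAlg :=
  (LinearMap.mulLeft ℂ a).mkContinuousOfExistsBound (exists_norm_mul_le a)

@[simp]
theorem leftMul_apply (a b : DyadicAlg) : leftMul a b = a * b := rfl

/-- The Hilbert space of the GNS representation of the direct limit with respect to its trace. -/
abbrev GNS : Type := UniformSpace.Completion DyadicAlg

open UniformSpace.Completion in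
/-- The GNS representation: `π a` is the bounded operator that extends left multiplication
by `a`. -/
def gns : DyadicAlg →⋆ₐ[ℂ] (GNS →L[ℂ] GNS) where
  toFun a := (leftMul a).completion
  map_one' := by
    ext c
    induction c using induction_on with
    | hp => apply isClosed_eq <;> fun_prop
    | ih c => simp
  map_mul' a b := by
    ext c
    induction c using induction_on with
    | hp => apply isClosed_eq <;> fun_prop
    | ih c => simp [mul_assoc]
  map_zero' := by
    ext c
    induction c using induction_on with
    | hp => apply isClosed_eq <;> fun_prop
    | ih c => simp
  map_add' a b := by
    ext c
    induction c using induction_on with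
    | hp => apply isClosed_eq <;> fun_prop
    | ih c => simp [add_mul, coe_add]
  commutes' r := by
    ext c
    induction c using induction_on with
    | hp => apply isClosed_eq <;> fun_prop
    | ih c => simp [Algebra.algebraMap_eq_smul_one]
  map_star' a := by
    refine (ContinuousLinearMap.eq_adjoint_iff (leftMul (star a)).completion
      (leftMul a).completion).mpr ?_
    intro x y
    induction x, y using induction_on₂ with
    | hp => apply isClosed_eq <;> fun_prop
    | ih x y => simp [mul_assoc, inner_def]

@[simp]
theorem gns_apply_coe (a b : DyadicAlg) : gns a (b : GNS) = ((a * b : DyadicAlg) : GNS) := by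
  simp [gns]

end DyadicAlg

/-! ### The hyperfinite II₁ factor -/

/-- The hyperfinite II₁ factor `𝓡`: the von Neumann algebra generated by the direct limit of the
matrix algebras `M_{2 ^ n}(ℂ)` in its GNS representation with respect to the trace. -/
def HyperfiniteR : VonNeumannAlgebra DyadicAlg.GNS where
  toStarSubalgebra := StarSubalgebra.centralizer ℂ (Set.centralizer (Set.range DyadicAlg.gns))
  centralizer_centralizer' := by
    change Set.centralizer (Set.centralizer (SetLike.coe (StarSubalgebra.centralizer ℂ
      (Set.centralizer (Set.range DyadicAlg.gns))))) = SetLike.coe (StarSubalgebra.centralizer ℂ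
      (Set.centralizer (Set.range DyadicAlg.gns)))
    rw [StarSubalgebra.coe_centralizer, Set.centralizer_centralizer_centralizer]

theorem coe_hyperfiniteR : (HyperfiniteR : Set (DyadicAlg.GNS →L[ℂ] DyadicAlg.GNS)) =
    Set.centralizer (Set.centralizer (Set.range DyadicAlg.gns)) := by
  have h : star (Set.range DyadicAlg.gns) = Set.range DyadicAlg.gns := by
    ext u
    constructor
    · rintro ⟨a, ha⟩
      exact ⟨star a, by rw [map_star, ha, star_star]⟩
    · rintro ⟨a, rfl⟩
      exact ⟨star a, by rw [map_star]⟩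
  have h2 : star (Set.centralizer (Set.range DyadicAlg.gns)) =
      Set.centralizer (Set.range DyadicAlg.gns) := by
    rw [Set.star_centralizer, h]
  change SetLike.coe (StarSubalgebra.centralizer ℂ
    (Set.centralizer (Set.range DyadicAlg.gns))) = _
  rw [StarSubalgebra.coe_centralizer, h2, Set.union_self]

/-- The trace `τ` of the hyperfinite II₁ factor: the vector state given by the class of `1`. -/
def traceR (u : HyperfiniteR) : ℂ :=
  inner ℂ ((1 : DyadicAlg) : DyadicAlg.GNS)
    ((u : DyadicAlg.GNS →L[ℂ] DyadicAlg.GNS) ((1 : DyadicAlg) : DyadicAlg.GNS))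

theorem gns_mem_hyperfiniteR (a : DyadicAlg) : DyadicAlg.gns a ∈ HyperfiniteR := by
  rw [← SetLike.mem_coe, coe_hyperfiniteR]
  exact Set.subset_centralizer_centralizer ⟨a, rfl⟩

theorem traceR_gns (a : DyadicAlg) :
    traceR ⟨DyadicAlg.gns a, gns_mem_hyperfiniteR a⟩ = DyadicAlg.trace a := by
  simp [traceR, DyadicAlg.inner_def]

/-- `X(n, M)`: the set of projection valued measures of length `n` in `M`. -/
def PVM (n : ℕ) (M : Type*) [Ring M] [StarRing M] : Set (Fin n → M) :=
  {e | (∀ a, IsStarProjection (e a)) ∧ ∑ a, e a = 1}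

/-- The set of `𝓡`-correlations with `k` questions and `n` answers. -/
def corrR (k n : ℕ) : Set (Corr k n) :=
  {p | (∀ x y a b, p x y a b ∈ Set.Icc (0 : ℝ) 1) ∧
    ∃ e : Fin k → Fin n → HyperfiniteR, (∀ x, e x ∈ PVM n HyperfiniteR) ∧
      ∀ x y a b, (p x y a b : ℂ) = traceR (e x a * e y b)}

end

/-!
Both closures equal the closure of the set `dyadicCorrSet` of the correlations `tr(f^x_a f^y_b)`
given by PVMs `f^x` in the matrix algebras `M_{2 ^ m}` with their normalized traces.

Dyadic correlations lie in both sets. The GNS representation turns dyadic PVMs into PVMs of the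
hyperfinite factor (`dyadicCorrSet_subset_corrR`), and `tr(P Q)` is the value of `P ⊗ Qᵀ` in the
maximally entangled state (`dyadicCorrSet_subset_syncQuantumCorr`).

Synchronous quantum correlations are limits of dyadic ones (`syncQuantumCorr_subset_closure`). If
`X` is the coefficient matrix of the state, then `p(a,b|x,y) = Tr(X* A^x_a X (B^y_b)ᵀ)`, and
synchronicity forces `A^x_a X = X (B^x_a)ᵀ`. Hence the density matrix `ρ = X X*` commutes with the
`A^x_a`, these are projections on its support, and `p(a,b|x,y) = Tr(ρ A^x_a A^y_b)`. In an
eigenbasis of `ρ`, repeating the basis vector of eigenvalue `λ` exactly `⌊2 ^ m λ⌋` times gives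
PVMs in `M_{2 ^ m}`, up to a part of the space of vanishing relative dimension, and the normalized
trace of the amplification tends to `Tr(ρ ·)`.

Correlations of the hyperfinite factor are limits of dyadic ones (`corrR_subset_closure`). The
conditional expectation of a PVM `e` onto `M_{2 ^ m}` is, at the level of GNS vectors, the
orthogonal projection onto a finite-dimensional subspace; it is a POVM `T`, and it converges to `e`
in 2-norm. A POVM of matrices is rounded to a PVM `P` by diagonalising `∑ a T_a` and assigning each
eigenvector to the outcome nearest to its eigenvalue. In an eigenvector, the outcomes follow a
distribution whose mean is the eigenvalue, so the mass of the other outcomes is at most four times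
the variance; summing up, `‖P_a - T_a‖²` is at most `4 tr(∑ a² T_a - (∑ a T_a)²)`
(`exists_pvm_near_povm`). This is continuous in the GNS vectors and vanishes for a PVM.
-/

noncomputable section

/-! ### Positive semidefinite matrices and rounding of POVMs -/

section MatrixLemmas

open scoped ComplexOrder MatrixOrder
open Matrix

theorem posSemidef_one_sub_of_sum_eq_one {ι : Type*} [DecidableEq ι] {n : ℕ}
    {T : Fin n → Matrix ι ι ℂ}
    (hT : ∀ a, (T a).PosSemidef) (hT1 : ∑ a, T a = 1) (a : Fin n) : (1 - T a).PosSemidef := by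
  rw [← hT1, ← Finset.add_sum_erase _ _ (Finset.mem_univ a), add_sub_cancel_left]
  exact posSemidef_sum _ fun b _ => hT b

variable {ι κ : Type*} [Fintype ι] [Fintype κ] [DecidableEq ι] [DecidableEq κ]

theorem Matrix.PosSemidef.exists_eq_conjTranspose_mul_self {A : Matrix ι ι ℂ}
    (hA : A.PosSemidef) : ∃ C : Matrix ι ι ℂ, A = Cᴴ * C :=
  CStarAlgebra.nonneg_iff_eq_star_mul_self.mp hA.nonneg

theorem Matrix.PosSemidef.trace_mul_nonneg {A B : Matrix ι ι ℂ}
    (hA : A.PosSemidef) (hB : B.PosSemidef) : 0 ≤ (A * B).trace := by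
  obtain ⟨C, rfl⟩ := hA.exists_eq_conjTranspose_mul_self
  rw [Matrix.mul_assoc, Matrix.trace_mul_comm]
  exact (hB.mul_mul_conjTranspose_same C).trace_nonneg

/-- The pairing `Tr(X* A X B)` of two positive semidefinite matrices through `X` vanishes only if
`A X B` does: it is the squared Hilbert–Schmidt norm of `A ^ (1 / 2) X B ^ (1 / 2)`. -/
theorem Matrix.PosSemidef.mul_mul_eq_zero_of_trace {A : Matrix ι ι ℂ} {B : Matrix κ κ ℂ}
    (hA : A.PosSemidef) (hB : B.PosSemidef) (X : Matrix ι κ ℂ)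
    (h : (Xᴴ * A * X * B).trace = 0) : A * X * B = 0 := by
  obtain ⟨C, rfl⟩ := hA.exists_eq_conjTranspose_mul_self
  obtain ⟨D, rfl⟩ := hB.exists_eq_conjTranspose_mul_self
  have h2 : ((C * X * Dᴴ)ᴴ * (C * X * Dᴴ)).trace = 0 := by
    rw [← h, ← Matrix.mul_assoc _ Dᴴ D, Matrix.trace_mul_comm _ D]
    simp only [conjTranspose_mul, conjTranspose_conjTranspose, Matrix.mul_assoc]
  rw [trace_conjTranspose_mul_self_eq_zero_iff] at h2
  calc Cᴴ * C * X * (Dᴴ * D) = Cᴴ * (C * X * Dᴴ) * D := by simp only [Matrix.mul_assoc]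
    _ = 0 := by simp [h2]

theorem Matrix.IsHermitian.exists_unitary_diagonal {H : Matrix ι ι ℂ} (hH : H.IsHermitian) :
    ∃ U : Matrix ι ι ℂ, Uᴴ * U = 1 ∧ U * Uᴴ = 1 ∧
      Uᴴ * H * U = diagonal (fun i => (hH.eigenvalues i : ℂ)) := by
  refine ⟨hH.eigenvectorUnitary, Unitary.coe_star_mul_self _, Unitary.coe_mul_star_self _, ?_⟩
  have := hH.conjStarAlgAut_star_eigenvectorUnitary
  rw [Unitary.conjStarAlgAut_star_apply] at this
  exact this

theorem isStarProjection_diagonal_ite (p : ι → Prop) [DecidablePred p] :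
    IsStarProjection (diagonal (fun i => if p i then (1 : ℂ) else 0)) := by
  refine ⟨?_, ?_⟩
  · rw [IsIdempotentElem, diagonal_mul_diagonal]
    congr 1; ext i; split_ifs <;> simp
  · rw [IsSelfAdjoint, star_eq_conjTranspose, diagonal_conjTranspose]
    congr 1; ext i; simp only [Pi.star_apply]; split_ifs <;> simp

/-- Rounding when `∑ a • T a` is diagonal. In each basis vector the diagonal entries of the `T a`
form a probability distribution on the outcomes, of mean `lam i`; the vector is assigned to the
outcome nearest to the mean, and the mass of the other outcomes is at most four times the
variance. -/
theorem exists_pvm_of_diagonal {n : ℕ} [NeZero n] {T : Fin n → Matrix ι ι ℂ}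
    (hT : ∀ a, (T a).PosSemidef) (hT1 : ∑ a, T a = 1) (lam : ι → ℝ)
    (hlam : ∑ a : Fin n, ((a : ℕ) : ℂ) • T a = diagonal (fun i => (lam i : ℂ))) :
    ∃ P ∈ PVM n (Matrix ι ι ℂ), ∀ a, (((P a - T a)ᴴ * (P a - T a)).trace).re ≤
      4 * ((∑ a : Fin n, ((a : ℕ) : ℝ) ^ 2 * (T a).trace.re) - ∑ i, lam i ^ 2) := by
  have hmin : ∀ i, ∃ b : Fin n, ∀ c : Fin n, |lam i - (b : ℕ)| ≤ |lam i - (c : ℕ)| :=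
    fun i => Finite.exists_min fun b : Fin n => |lam i - (b : ℕ)|
  choose g hg using hmin
  set t : Fin n → ι → ℝ := fun a i => (T a i i).re with ht
  have t_nonneg : ∀ a i, 0 ≤ t a i := fun a i => (Complex.nonneg_iff.1 (hT a).diag_nonneg).1
  have t_sum : ∀ i, ∑ a, t a i = 1 := fun i => by
    have := congrArg (fun M : Matrix ι ι ℂ => (M i i).re) hT1
    simpa [Matrix.sum_apply] using this
  have t_mean : ∀ i, ∑ a : Fin n, ((a : ℕ) : ℝ) * t a i = lam i := fun i => by
    have := congrArg (fun M : Matrix ι ι ℂ => (M i i).re) hlam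
    simpa [Matrix.sum_apply] using this
  have far : ∀ i b, b ≠ g i → 1 / 4 ≤ ((b : ℕ) - lam i) ^ 2 := by
    intro i b hb
    have h1 : (1 : ℝ) ≤ |((b : ℕ) : ℝ) - ((g i : ℕ) : ℝ)| := by
      have : (1 : ℤ) ≤ |((b : ℕ) : ℤ) - ((g i : ℕ) : ℤ)| :=
        Int.one_le_abs (sub_ne_zero.2 fun h => hb (Fin.ext (by exact_mod_cast h)))
      exact_mod_cast this
    have h2 := abs_sub_le ((b : ℕ) : ℝ) (lam i) ((g i : ℕ) : ℝ)
    have h3 := hg i b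
    rw [abs_sub_comm (lam i) ((b : ℕ) : ℝ)] at h3
    have h4 : 1 / 2 ≤ |((b : ℕ) : ℝ) - lam i| := by linarith
    rw [← sq_abs]
    nlinarith
  have mass : ∀ i, ∑ b ∈ Finset.univ.erase (g i), t b i ≤
      4 * (∑ a : Fin n, ((a : ℕ) : ℝ) ^ 2 * t a i - lam i ^ 2) := by
    intro i
    have hvar : ∑ a : Fin n, (((a : ℕ) : ℝ) - lam i) ^ 2 * t a i =
        ∑ a : Fin n, ((a : ℕ) : ℝ) ^ 2 * t a i - lam i ^ 2 := by
      have : ∀ a : Fin n, (((a : ℕ) : ℝ) - lam i) ^ 2 * t a i = ((a : ℕ) : ℝ) ^ 2 * t a i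
          - 2 * lam i * (((a : ℕ) : ℝ) * t a i) + lam i ^ 2 * t a i := fun a => by ring
      simp only [this, Finset.sum_add_distrib, Finset.sum_sub_distrib, ← Finset.mul_sum, t_mean,
        t_sum]
      ring
    rw [← hvar, Finset.mul_sum]
    calc ∑ b ∈ Finset.univ.erase (g i), t b i
        ≤ ∑ b ∈ Finset.univ.erase (g i), 4 * ((((b : ℕ) : ℝ) - lam i) ^ 2 * t b i) := by
          refine Finset.sum_le_sum fun b hb => ?_
          nlinarith [far i b (Finset.ne_of_mem_erase hb), t_nonneg b i]
      _ ≤ _ := Finset.sum_le_sum_of_subset_of_nonneg (Finset.erase_subset _ _)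
          fun b _ _ => by have := t_nonneg b i; positivity
  refine ⟨fun a => diagonal fun i => if g i = a then 1 else 0,
    ⟨fun a => isStarProjection_diagonal_ite _, ?_⟩, fun a => ?_⟩
  · ext i j
    rw [Matrix.sum_apply]
    by_cases hij : i = j
    · subst hij; simp
    · simp [hij]
  set P : Matrix ι ι ℂ := diagonal fun i => if g i = a then 1 else 0 with hP
  have hPP : IsStarProjection P := isStarProjection_diagonal_ite _
  have hexp : ((P - T a)ᴴ * (P - T a)).trace =
      P.trace - (P * T a).trace - (P * T a).trace + (T a * T a).trace := by
    rw [conjTranspose_sub, (hT a).1.eq, ← star_eq_conjTranspose, hPP.isSelfAdjoint.star_eq,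
      sub_mul, mul_sub, mul_sub, hPP.isIdempotentElem.eq, trace_sub, trace_sub, trace_sub,
      trace_mul_comm (T a) P]
    ring
  have hTT : (T a * T a).trace.re ≤ (T a).trace.re := by
    have := (Complex.nonneg_iff.1 ((hT a).trace_mul_nonneg
      (posSemidef_one_sub_of_sum_eq_one hT hT1 a))).1
    rw [mul_sub, mul_one, trace_sub, Complex.sub_re] at this
    linarith
  have hsum : (P.trace - (P * T a).trace - (P * T a).trace + (T a).trace).re =
      ∑ i, if g i = a then 1 - t a i else t a i := by
    simp only [Matrix.trace, Matrix.diag, hP, diagonal_mul, ← Finset.sum_sub_distrib,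
      ← Finset.sum_add_distrib, Complex.re_sum]
    refine Finset.sum_congr rfl fun i _ => ?_
    split_ifs with h
    · simp [ht, h]
    · simp [ht, h]
  calc (((P - T a)ᴴ * (P - T a)).trace).re
      ≤ (P.trace - (P * T a).trace - (P * T a).trace + (T a).trace).re := by
        rw [hexp]; simp only [Complex.add_re, Complex.sub_re]; linarith
    _ = ∑ i, if g i = a then 1 - t a i else t a i := hsum
    _ ≤ ∑ i, ∑ b ∈ Finset.univ.erase (g i), t b i := by
        refine Finset.sum_le_sum fun i _ => ?_
        split_ifs with h
        · rw [← t_sum i, ← Finset.add_sum_erase _ _ (Finset.mem_univ (g i)), h]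
          simp
        · exact Finset.single_le_sum (f := fun b => t b i) (fun b _ => t_nonneg b i)
            (Finset.mem_erase.2 ⟨fun h2 => h h2.symm, Finset.mem_univ a⟩)
    _ ≤ ∑ i, 4 * (∑ a : Fin n, ((a : ℕ) : ℝ) ^ 2 * t a i - lam i ^ 2) :=
        Finset.sum_le_sum fun i _ => mass i
    _ = _ := by
        rw [← Finset.mul_sum, Finset.sum_sub_distrib, Finset.sum_comm]
        simp [Matrix.trace, ht, Finset.mul_sum]

/-- A POVM of matrices is close in 2-norm to a PVM as soon as the variance of `∑ a • T a`,
measured by the trace, is small: conjugate by a unitary that diagonalises `∑ a • T a` and round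
its eigenvalues to the nearest outcome. -/
theorem exists_pvm_near_povm {n : ℕ} [NeZero n] {T : Fin n → Matrix ι ι ℂ}
    (hT : ∀ a, (T a).PosSemidef) (hT1 : ∑ a, T a = 1) :
    ∃ P ∈ PVM n (Matrix ι ι ℂ), ∀ a, (((P a - T a)ᴴ * (P a - T a)).trace).re ≤
      4 * ((∑ a : Fin n, ((a : ℕ) : ℝ) ^ 2 * (T a).trace.re) -
        (((∑ a : Fin n, ((a : ℕ) : ℂ) • T a)ᴴ * ∑ a : Fin n, ((a : ℕ) : ℂ) • T a).trace).re) := by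
  set H := ∑ a : Fin n, ((a : ℕ) : ℂ) • T a with hHdef
  have hH : H.IsHermitian := by
    rw [IsHermitian, hHdef, conjTranspose_sum]
    exact Finset.sum_congr rfl fun a _ => by rw [conjTranspose_smul, (hT a).1.eq]; simp
  obtain ⟨U, hU, hU', hd⟩ := hH.exists_unitary_diagonal
  have htr : ∀ M : Matrix ι ι ℂ, (Uᴴ * M * U).trace = M.trace := fun M => by
    rw [trace_mul_comm, ← Matrix.mul_assoc, hU', Matrix.one_mul]
  obtain ⟨P, ⟨hP, hP1⟩, hle⟩ := exists_pvm_of_diagonal (T := fun a => Uᴴ * T a * U)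
    (fun a => (hT a).conjTranspose_mul_mul_same U)
    (by rw [← Finset.sum_mul, ← Finset.mul_sum, hT1, Matrix.mul_one, hU]) hH.eigenvalues
    (by rw [← hd, hHdef, Finset.mul_sum, Finset.sum_mul]
        exact Finset.sum_congr rfl fun a _ => by rw [Matrix.mul_smul, Matrix.smul_mul])
  refine ⟨fun a => U * P a * Uᴴ, ⟨fun a => ⟨?_, ?_⟩, ?_⟩, fun a => ?_⟩
  · calc U * P a * Uᴴ * (U * P a * Uᴴ) = U * P a * (Uᴴ * U) * P a * Uᴴ := by
          simp only [Matrix.mul_assoc]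
      _ = U * (P a * P a) * Uᴴ := by rw [hU, Matrix.mul_one, Matrix.mul_assoc U]
      _ = _ := by rw [(hP a).isIdempotentElem.eq]
  · have := (hP a).isSelfAdjoint.star_eq
    rw [star_eq_conjTranspose] at this
    rw [IsSelfAdjoint, star_eq_conjTranspose, conjTranspose_mul, conjTranspose_mul, this,
      conjTranspose_conjTranspose]
    exact (Matrix.mul_assoc _ _ _).symm
  · rw [← Finset.sum_mul, ← Finset.mul_sum, hP1, Matrix.mul_one, hU']
  · have hsq : (Hᴴ * H).trace.re = ∑ i, hH.eigenvalues i ^ 2 := by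
      rw [hH.eq, ← htr]
      have : Uᴴ * (H * H) * U = (Uᴴ * H * U) * (Uᴴ * H * U) := by
        calc Uᴴ * (H * H) * U = Uᴴ * H * 1 * H * U := by simp only [Matrix.mul_assoc, mul_one]
          _ = _ := by rw [← hU']; simp only [Matrix.mul_assoc]
      rw [this, hd, diagonal_mul_diagonal, trace_diagonal, Complex.re_sum]
      refine Finset.sum_congr rfl fun i _ => ?_
      rw [← Complex.ofReal_mul, Complex.ofReal_re, sq]
    have hPT : U * P a * Uᴴ - T a = U * (P a - Uᴴ * T a * U) * Uᴴ := by
      rw [Matrix.mul_sub, Matrix.sub_mul]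
      congr 1
      calc T a = (U * Uᴴ) * T a * (U * Uᴴ) := by rw [hU', Matrix.one_mul, Matrix.mul_one]
        _ = _ := by simp only [Matrix.mul_assoc]
    have h := hle a
    simp only [htr] at h
    rw [hsq, hPT]
    refine le_of_eq_of_le ?_ h
    set Q := P a - Uᴴ * T a * U
    have : (U * Q * Uᴴ)ᴴ * (U * Q * Uᴴ) = Uᴴᴴ * (Qᴴ * Q) * Uᴴ := by
      rw [conjTranspose_mul, conjTranspose_mul]
      calc Uᴴᴴ * (Qᴴ * Uᴴ) * (U * Q * Uᴴ) = Uᴴᴴ * Qᴴ * (Uᴴ * U) * Q * Uᴴ := by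
            simp only [Matrix.mul_assoc]
        _ = _ := by rw [hU, Matrix.mul_one]; simp only [Matrix.mul_assoc]
    rw [this, trace_mul_comm, ← Matrix.mul_assoc, conjTranspose_conjTranspose, hU, Matrix.one_mul]

end MatrixLemmas

/-! ### Orthogonality of projections summing to one -/

section Orthogonality

/-- Projections on a Hilbert space that sum to `1` are mutually orthogonal. -/
theorem mul_eq_zero_of_isStarProjection_of_sum_eq_one {H : Type*} [NormedAddCommGroup H]
    [InnerProductSpace ℂ H] [CompleteSpace H] {n : ℕ} {e : Fin n → (H →L[ℂ] H)}
    (he : e ∈ PVM n (H →L[ℂ] H)) {a b : Fin n} (hab : a ≠ b) : e a * e b = 0 := by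
  have hinner : ∀ c w, inner ℂ w (e c w) = ((‖e c w‖ ^ 2 : ℝ) : ℂ) := fun c w => by
    have h1 : e c w = ContinuousLinearMap.adjoint (e c) (e c w) := by
      rw [← ContinuousLinearMap.star_eq_adjoint, (he.1 c).isSelfAdjoint.star_eq,
        ← mul_apply_eq_comp, (he.1 c).isIdempotentElem.eq]
    conv_lhs => rw [h1, ContinuousLinearMap.adjoint_inner_right]
    rw [inner_self_eq_norm_sq_to_K]; norm_cast
  ext w
  -- The squared norms of the `e c (e b w)` sum to that of `e b w`, which the term `c = b` exhausts.
  have hsum : ∑ c, ‖e c (e b w)‖ ^ 2 = ‖e b w‖ ^ 2 := by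
    have h1 : inner ℂ (e b w) ((∑ c, e c) (e b w)) = ((∑ c, ‖e c (e b w)‖ ^ 2 : ℝ) : ℂ) := by
      rw [_root_.sum_apply, inner_sum]
      simp only [hinner]
      push_cast; rfl
    rw [he.2, one_apply_eq_self, inner_self_eq_norm_sq_to_K] at h1
    rw [← RCLike.ofReal_pow] at h1
    exact (RCLike.ofReal_injective h1).symm
  have hbb : e b (e b w) = e b w := by
    rw [← mul_apply_eq_comp, (he.1 b).isIdempotentElem.eq]
  rw [← Finset.add_sum_erase _ _ (Finset.mem_univ b), hbb, add_eq_left,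
    Finset.sum_eq_zero_iff_of_nonneg fun c _ => by positivity] at hsum
  simpa using hsum a (by simp [hab])

end Orthogonality

/-! ### Vectors of tensor products as matrices -/

section VectorsOfTensorProducts

open Matrix

variable {E F : Type*} [NormedAddCommGroup E] [InnerProductSpace ℂ E]
  [NormedAddCommGroup F] [InnerProductSpace ℂ F]
variable {ι κ : Type*} [Fintype ι] [Fintype κ]

/-- The vector `∑ X i j • u i ⊗ v j` of coefficient matrix `X`. -/
def matrixVec (u : ι → E) (v : κ → F) (X : Matrix ι κ ℂ) : E ⊗[ℂ] F :=
  ∑ i, ∑ j, X i j • u i ⊗ₜ[ℂ] v j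

/-- For orthonormal bases `u` and `v`, `A ⊗ B` acts on coefficient matrices as `X ↦ A X Bᵀ`, and
the inner product is the Hilbert–Schmidt one. The formula itself needs no orthonormality. -/
theorem inner_map_matrixVec (u : ι → E) (v : κ → F) (X : Matrix ι κ ℂ)
    (A : E →ₗ[ℂ] E) (B : F →ₗ[ℂ] F) :
    inner ℂ (matrixVec u v X) (TensorProduct.map A B (matrixVec u v X)) =
      (Xᴴ * (Matrix.of fun i j => inner ℂ (u i) (A (u j))) * X *
        (Matrix.of fun i j => inner ℂ (v i) (B (v j)))ᵀ).trace := by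
  simp only [matrixVec, map_sum, map_smul, TensorProduct.map_tmul]
  -- The instances on `E ⊗ F` only match after unfolding the inner product to a sesquilinear map.
  simp only [TensorProduct.inner_def, map_sum, map_smulₛₗ, LinearMap.sum_apply,
    LinearMap.smul_apply, RingHom.id_apply, smul_eq_mul]
  simp only [← TensorProduct.inner_def, TensorProduct.inner_tmul, starRingEnd_apply]
  simp only [Matrix.trace, Matrix.diag, Matrix.mul_apply, conjTranspose_apply, of_apply,
    transpose_apply, Finset.sum_mul]
  rw [Finset.sum_comm]
  refine Eq.trans (Finset.sum_congr rfl fun l _ => ?_) Finset.sum_comm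
  refine Eq.trans (Finset.sum_congr rfl fun p _ => ?_) Finset.sum_comm
  rw [Finset.mul_sum]
  refine Eq.trans (Finset.sum_congr rfl fun i _ => ?_) Finset.sum_comm
  rw [Finset.mul_sum]
  refine Finset.sum_congr rfl fun j _ => ?_
  ring

end VectorsOfTensorProducts

/-! ### Dyadic correlations -/

section DyadicCorrelations

open scoped ComplexOrder
open Matrix

/-- The correlation `tr(f^x_a f^y_b)` of tuples of matrices of size `2 ^ m`, for the normalized
trace. -/
def dyadicCorr {k n : ℕ} (m : ℕ) (f : Fin k → Fin n → DyadicMatrix m) : Corr k n :=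
  fun x y a b => (dyadicTrace m (f x a * f y b)).re

/-- The correlations `tr(f^x_a f^y_b)` of PVMs in the dyadic matrix algebras. -/
def dyadicCorrSet (k n : ℕ) : Set (Corr k n) :=
  {p | ∃ (m : ℕ) (f : Fin k → Fin n → DyadicMatrix m),
    (∀ x, f x ∈ PVM n (DyadicMatrix m)) ∧ p = dyadicCorr m f}

theorem IsStarProjection.posSemidef {ι : Type*} [Fintype ι] {P : Matrix ι ι ℂ}
    (hP : IsStarProjection P) : P.PosSemidef := by
  have h := hP.isSelfAdjoint.star_eq
  rw [← hP.isIdempotentElem.eq]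
  nth_rw 1 [← h]
  exact posSemidef_conjTranspose_mul_self P

theorem dyadicTrace_apply (m : ℕ) (A : DyadicMatrix m) :
    dyadicTrace m A = ((2 : ℂ) ^ m)⁻¹ * A.trace := rfl

theorem dyadicTrace_one (m : ℕ) : dyadicTrace m 1 = 1 := by
  simp [dyadicTrace_apply]

theorem dyadicTrace_mul_nonneg {m : ℕ} {A B : DyadicMatrix m} (hA : A.PosSemidef)
    (hB : B.PosSemidef) : 0 ≤ dyadicTrace m (A * B) :=
  mul_nonneg (by positivity) (hA.trace_mul_nonneg hB)

variable {k n m : ℕ} {f : Fin k → Fin n → DyadicMatrix m}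

theorem ofReal_dyadicCorr (hf : ∀ x, f x ∈ PVM n (DyadicMatrix m)) (x y : Fin k) (a b : Fin n) :
    (dyadicCorr m f x y a b : ℂ) = dyadicTrace m (f x a * f y b) := by
  have := dyadicTrace_mul_nonneg ((hf x).1 a).posSemidef ((hf y).1 b).posSemidef
  exact Complex.ext rfl (Complex.nonneg_iff.1 this).2

theorem dyadicCorr_mem_Icc (hf : ∀ x, f x ∈ PVM n (DyadicMatrix m)) (x y : Fin k)
    (a b : Fin n) : dyadicCorr m f x y a b ∈ Set.Icc (0 : ℝ) 1 := by
  have h0 : ∀ a b, 0 ≤ dyadicCorr m f x y a b := fun a b => (Complex.nonneg_iff.1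
    (dyadicTrace_mul_nonneg ((hf x).1 a).posSemidef ((hf y).1 b).posSemidef)).1
  have h1 : ∑ a, ∑ b, dyadicCorr m f x y a b = 1 := by
    simp only [dyadicCorr, ← Complex.re_sum, ← map_sum, ← Finset.mul_sum, (hf y).2, mul_one,
      (hf x).2, dyadicTrace_one, Complex.one_re]
  refine ⟨h0 a b, ?_⟩
  rw [← h1]
  exact (Finset.single_le_sum (fun b _ => h0 a b) (Finset.mem_univ b)).trans
    (Finset.single_le_sum (f := fun a => ∑ b, dyadicCorr m f x y a b)
      (fun a _ => Finset.sum_nonneg fun b _ => h0 a b) (Finset.mem_univ a))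

theorem gns_of_mem_PVM {g : Fin n → DyadicMatrix m} (hg : g ∈ PVM n (DyadicMatrix m)) :
    (fun a => DyadicAlg.gns (DyadicAlg.of m (g a))) ∈
      PVM n (DyadicAlg.GNS →L[ℂ] DyadicAlg.GNS) := by
  refine ⟨fun a => ⟨?_, ?_⟩, ?_⟩
  · rw [IsIdempotentElem, ← map_mul, ← map_mul, (hg.1 a).isIdempotentElem.eq]
  · rw [IsSelfAdjoint, ← map_star, ← map_star, (hg.1 a).isSelfAdjoint.star_eq]
  · rw [← map_sum, ← map_sum, hg.2, map_one, map_one]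

theorem dyadicTrace_mul_eq_zero {g : Fin n → DyadicMatrix m} (hg : g ∈ PVM n (DyadicMatrix m))
    {a b : Fin n} (hab : a ≠ b) : dyadicTrace m (g a * g b) = 0 := by
  rw [← DyadicAlg.trace_of, ← traceR_gns]
  have := mul_eq_zero_of_isStarProjection_of_sum_eq_one (gns_of_mem_PVM hg) hab
  rw [← map_mul] at this
  simp [traceR, -DyadicAlg.gns_apply_coe, this]

theorem dyadicCorrSet_subset_corrR (k n : ℕ) : dyadicCorrSet k n ⊆ corrR k n := by
  rintro p ⟨m, f, hf, rfl⟩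
  refine ⟨dyadicCorr_mem_Icc hf,
    fun x a => ⟨DyadicAlg.gns (DyadicAlg.of m (f x a)), gns_mem_hyperfiniteR _⟩, fun x => ?_, ?_⟩
  · have h := gns_of_mem_PVM (hf x)
    refine ⟨fun a => ⟨Subtype.ext (h.1 a).isIdempotentElem, Subtype.ext (h.1 a).isSelfAdjoint⟩,
      Subtype.ext ?_⟩
    refine Eq.trans ?_ h.2
    exact map_sum (HyperfiniteR.toStarSubalgebra.subtype) _ _
  · intro x y a b
    rw [ofReal_dyadicCorr hf, ← DyadicAlg.trace_of, ← traceR_gns]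
    congr 1
    exact Subtype.ext (by simp only [map_mul]; rfl)

/-- The maximally entangled state on `ℂ ^ N ⊗ ℂ ^ N`. -/
def maxEntangled (N : ℕ) : EuclideanSpace ℂ (Fin N) ⊗[ℂ] EuclideanSpace ℂ (Fin N) :=
  matrixVec (EuclideanSpace.basisFun (Fin N) ℂ) (EuclideanSpace.basisFun (Fin N) ℂ)
    (((Real.sqrt N)⁻¹ : ℝ) • 1)

theorem inner_maxEntangled {N : ℕ} (A B : Matrix (Fin N) (Fin N) ℂ) :
    inner ℂ (maxEntangled N) (TensorProduct.map (toEuclideanLin A) (toEuclideanLin B)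
      (maxEntangled N)) = (N : ℂ)⁻¹ * (A * Bᵀ).trace := by
  have hN : (Real.sqrt N)⁻¹ * (Real.sqrt N)⁻¹ = (N : ℝ)⁻¹ := by
    rw [← mul_inv, Real.mul_self_sqrt (by positivity)]
  have hentry : ∀ (C : Matrix (Fin N) (Fin N) ℂ), (Matrix.of fun i j =>
      inner ℂ (EuclideanSpace.basisFun (Fin N) ℂ i)
        (toEuclideanLin C (EuclideanSpace.basisFun (Fin N) ℂ j))) = C := by
    intro C
    ext i j
    simp [toLpLin_apply, EuclideanSpace.inner_single_left]
  rw [maxEntangled, inner_map_matrixVec, hentry, hentry]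
  simp only [conjTranspose_smul, star_trivial, conjTranspose_one, one_mul,
    mul_one, smul_smul, hN, trace_smul, smul_mul_assoc, mul_smul_comm]
  rw [Complex.real_smul]; push_cast; rfl

theorem dyadicCorrSet_subset_syncQuantumCorr (k n : ℕ) :
    dyadicCorrSet k n ⊆ syncQuantumCorr k n := by
  rintro p ⟨m, f, hf, rfl⟩
  refine ⟨⟨EuclideanSpace ℂ (Fin (2 ^ m)), EuclideanSpace ℂ (Fin (2 ^ m)), inferInstance,
    inferInstance, inferInstance, inferInstance, inferInstance, inferInstance,
    fun x a => toEuclideanLin (f x a), fun y b => toEuclideanLin (f y b)ᵀ,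
    maxEntangled _, fun x => ⟨fun a => ?_, ?_⟩, fun y => ⟨fun b => ?_, ?_⟩, ?_, ?_⟩, ?_⟩
  · exact isPositive_toEuclideanLin_iff.2 ((hf x).1 a).posSemidef
  · rw [← map_sum, (hf x).2]
    exact toLpLin_one _
  · exact isPositive_toEuclideanLin_iff.2 ((hf y).1 b).posSemidef.transpose
  · rw [← map_sum, ← transpose_sum, (hf y).2, transpose_one]
    exact toLpLin_one _
  · have h := inner_maxEntangled (1 : Matrix (Fin (2 ^ m)) (Fin (2 ^ m)) ℂ) 1
    have h1 : toEuclideanLin (1 : Matrix (Fin (2 ^ m)) (Fin (2 ^ m)) ℂ) = LinearMap.id :=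
      toLpLin_one _
    rw [h1, TensorProduct.map_id, LinearMap.id_apply] at h
    have h2 : ‖maxEntangled (2 ^ m)‖ ^ 2 = 1 := by
      rw [← inner_self_eq_norm_sq (𝕜 := ℂ)]
      refine (congrArg RCLike.re h).trans ?_
      simp
    exact (pow_eq_one_iff_of_nonneg (norm_nonneg _) two_ne_zero).1 h2
  · intro x y a b
    rw [ofReal_dyadicCorr hf, inner_maxEntangled, transpose_transpose, dyadicTrace_apply]
    simp
  · intro x a b hab
    rw [dyadicCorr, dyadicTrace_mul_eq_zero (hf x) hab, Complex.zero_re]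

end DyadicCorrelations

/-! ### Synchronous quantum correlations as limits of dyadic ones -/

section Amplification

open Matrix

variable {ι : Type*}

/-- The amplification of `A` in which the basis vector `i` is repeated `c i` times: the copies with
number `s` span a compression of `A` to the indices `i` with `s < c i`. It is an honest direct sum
of blocks of `A` if the nonzero entries of `A` only link indices of equal multiplicity. -/
def amplify (c : ι → ℕ) (A : Matrix ι ι ℂ) : Matrix (Σ i, Fin (c i)) (Σ i, Fin (c i)) ℂ :=
  Matrix.of fun p q => if (p.2 : ℕ) = q.2 then A p.1 q.1 else 0

theorem amplify_one [DecidableEq ι] (c : ι → ℕ) : amplify c 1 = 1 := by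
  ext ⟨i, s⟩ ⟨j, t⟩
  by_cases h : i = j
  · subst h
    simp [amplify, Matrix.one_apply, Fin.ext_iff]
  · simp [amplify, Matrix.one_apply, h]

theorem amplify_sum {n : ℕ} (c : ι → ℕ) (A : Fin n → Matrix ι ι ℂ) :
    amplify c (∑ a, A a) = ∑ a, amplify c (A a) := by
  ext p q
  by_cases h : (p.2 : ℕ) = q.2 <;> simp [amplify, Matrix.sum_apply, h]

theorem conjTranspose_amplify (c : ι → ℕ) (A : Matrix ι ι ℂ) :
    (amplify c A)ᴴ = amplify c Aᴴ := by
  ext p q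
  by_cases h : (p.2 : ℕ) = q.2
  · simp [amplify, h]
  · simp [amplify, h, Ne.symm h]

variable [Fintype ι]

theorem amplify_mul (c : ι → ℕ) {A : Matrix ι ι ℂ} (hA : ∀ i j, A i j ≠ 0 → c i = c j)
    (B : Matrix ι ι ℂ) : amplify c A * amplify c B = amplify c (A * B) := by
  ext ⟨i, s⟩ ⟨j, t⟩
  simp only [amplify, Matrix.mul_apply, of_apply, Fintype.sum_sigma]
  have : ∀ l, ∑ r : Fin (c l), (if (s : ℕ) = r then A i l else 0) *
      (if (r : ℕ) = t then B l j else 0) = if (s : ℕ) = t then A i l * B l j else 0 := by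
    intro l
    by_cases hl : A i l = 0
    · simp [hl]
    · rw [Finset.sum_eq_single (⟨s, hA i l hl ▸ s.2⟩ : Fin (c l))]
      · simp
      · intro r _ hr
        rw [if_neg fun h => hr (Fin.ext h.symm), zero_mul]
      · simp
  simp only [this]
  split_ifs <;> simp

theorem trace_amplify (c : ι → ℕ) (A : Matrix ι ι ℂ) :
    (amplify c A).trace = ∑ i, (c i : ℂ) * A i i := by
  simp [amplify, Matrix.trace, Fintype.sum_sigma]

variable [DecidableEq ι]

/-- Matrices that are PVMs on the indices of nonzero multiplicity can be amplified to PVMs in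
`M_{2 ^ m}`; the dimensions left over are given to the first outcome. -/
theorem exists_dyadic_pvm_amplify {k n : ℕ} [NeZero n] {A : Fin k → Fin n → Matrix ι ι ℂ}
    (hA : ∀ x a, (A x a).IsHermitian) (hA1 : ∀ x, ∑ a, A x a = 1) (c : ι → ℕ)
    (hc : ∀ x a i j, A x a i j ≠ 0 → c i = c j)
    (hAA : ∀ x a i j, c j ≠ 0 → (A x a * A x a) i j = A x a i j)
    {m : ℕ} (hm : ∑ i, c i ≤ 2 ^ m) :
    ∃ f : Fin k → Fin n → DyadicMatrix m, (∀ x, f x ∈ PVM n (DyadicMatrix m)) ∧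
      ∀ x y a b, (f x a * f y b).trace = ∑ i, (c i : ℂ) * (A x a * A y b) i i +
        ((2 ^ m : ℂ) - ∑ i, (c i : ℂ)) * if a = 0 ∧ b = 0 then 1 else 0 := by
  have hcard : Fintype.card ((Σ i, Fin (c i)) ⊕ Fin (2 ^ m - ∑ i, c i)) =
      Fintype.card (Fin (2 ^ m)) := by
    simp [Nat.add_sub_cancel' hm]
  let φ := reindexAlgEquiv ℂ ℂ (Fintype.equivOfCardEq hcard)
  have hφ : ∀ M, (φ M)ᴴ = φ Mᴴ := fun M => by simp [φ]
  have hφtr : ∀ M, (φ M).trace = M.trace := fun M =>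
    Equiv.sum_comp (Fintype.equivOfCardEq hcard).symm fun i => M i i
  let d : Fin n → Matrix (Fin (2 ^ m - ∑ i, c i)) (Fin (2 ^ m - ∑ i, c i)) ℂ :=
    fun a => if a = 0 then 1 else 0
  have hdH : ∀ a, (d a)ᴴ = d a := fun a => by by_cases h : a = 0 <;> simp [d, h]
  have hdmul : ∀ a b, d a * d b = if a = 0 ∧ b = 0 then 1 else 0 := fun a b => by
    by_cases h : a = 0 <;> by_cases h' : b = 0 <;> simp [d, h, h']
  have hid : ∀ x a, amplify c (A x a) * amplify c (A x a) = amplify c (A x a) := by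
    intro x a
    rw [amplify_mul c (hc x a)]
    ext ⟨i, s⟩ ⟨j, t⟩
    have hj : c j ≠ 0 := fun h => absurd t.2 (by simp [h])
    simp [amplify, hAA x a i j hj]
  refine ⟨fun x a => φ (fromBlocks (amplify c (A x a)) 0 0 (d a)),
    fun x => ⟨fun a => ⟨?_, ?_⟩, ?_⟩, fun x y a b => ?_⟩
  · rw [IsIdempotentElem, ← map_mul, fromBlocks_multiply]
    congr 2
    · simp [hid]
    · simp
    · simp
    · rw [hdmul]; by_cases h : a = 0 <;> simp [d, h]
  · rw [IsSelfAdjoint, star_eq_conjTranspose, hφ, fromBlocks_conjTranspose, hdH,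
      conjTranspose_amplify, (hA x a).eq]
    simp
  · have h1 : ∑ a, fromBlocks (amplify c (A x a)) 0 0 (d a) =
        fromBlocks (∑ a, amplify c (A x a)) 0 0 (∑ a, d a) := by
      ext (i | i) (j | j) <;> simp [Matrix.sum_apply]
    rw [← map_sum, h1, ← amplify_sum, hA1, amplify_one]
    simp [d]
  · have htr : ∀ P S, (fromBlocks P 0 0 S : Matrix ((Σ i, Fin (c i)) ⊕ Fin (2 ^ m - ∑ i, c i))
        ((Σ i, Fin (c i)) ⊕ Fin (2 ^ m - ∑ i, c i)) ℂ).trace = P.trace + S.trace :=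
      fun P S => by simp [Matrix.trace]
    rw [← map_mul, hφtr, fromBlocks_multiply]
    simp only [Matrix.mul_zero, Matrix.zero_mul, add_zero, zero_add]
    rw [htr, amplify_mul c (hc x a), trace_amplify, hdmul]
    congr 1
    split_ifs
    · simp [Nat.cast_sub hm]
    · simp

open Filter Topology in
/-- A correlation `Tr(diag(lam) A^x_a A^y_b)` with a density matrix that commutes with the `A^x_a`
and on whose support they are PVMs is a limit of dyadic correlations: repeat the index `i`
`⌊2 ^ m * lam i⌋` times. -/
theorem mem_closure_dyadicCorrSet_of_diagonal {k n : ℕ} [NeZero n]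
    {A : Fin k → Fin n → Matrix ι ι ℂ}
    (hA : ∀ x a, (A x a).IsHermitian) (hA1 : ∀ x, ∑ a, A x a = 1)
    {lam : ι → ℝ} (hlam : ∀ i, 0 ≤ lam i) (hlam1 : ∑ i, lam i = 1)
    (hcomm : ∀ x a, A x a * diagonal (fun i => (lam i : ℂ)) =
      diagonal (fun i => (lam i : ℂ)) * A x a)
    (hAA : ∀ x a, A x a * A x a * diagonal (fun i => (lam i : ℂ)) =
      A x a * diagonal (fun i => (lam i : ℂ)))
    {p : Corr k n} (hp : ∀ x y a b, (p x y a b : ℂ) =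
      (A x a * A y b * diagonal (fun i => (lam i : ℂ))).trace) :
    p ∈ closure (dyadicCorrSet k n) := by
  let c : ℕ → ι → ℕ := fun m i => ⌊lam i * 2 ^ m⌋₊
  have hsum : ∀ m, ∑ i, c m i ≤ 2 ^ m := fun m => by
    have : ((∑ i, c m i : ℕ) : ℝ) ≤ 2 ^ m := by
      rw [Nat.cast_sum, ← one_mul ((2 : ℝ) ^ m), ← hlam1, Finset.sum_mul]
      exact Finset.sum_le_sum fun i _ => Nat.floor_le (mul_nonneg (hlam i) (by positivity))
    exact_mod_cast this
  have hf := fun m => exists_dyadic_pvm_amplify hA hA1 (c m)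
    (fun x a i j hij => by
      have := congrFun (congrFun (hcomm x a) i) j
      rw [mul_diagonal, diagonal_mul, mul_comm] at this
      have h : lam i = lam j := by exact_mod_cast (mul_right_cancel₀ hij this).symm
      simp only [c, h])
    (fun x a i j hj => by
      have := congrFun (congrFun (hAA x a) i) j
      rw [mul_diagonal, mul_diagonal] at this
      refine mul_right_cancel₀ (fun h => hj ?_) this
      have h0 : lam j = 0 := by exact_mod_cast h
      simp [c, h0]) (hsum m)
  choose f hfP hftr using hf
  have hlim : ∀ i, Tendsto (fun m => (c m i : ℝ) / 2 ^ m) atTop (𝓝 (lam i)) := fun i =>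
    (tendsto_nat_floor_mul_div_atTop (hlam i)).comp
      (tendsto_pow_atTop_atTop_of_one_lt (one_lt_two (α := ℝ)))
  refine mem_closure_of_tendsto (f := fun m => dyadicCorr m (f m)) (b := atTop) ?_
    (Eventually.of_forall fun m => ⟨m, f m, hfP m, rfl⟩)
  simp only [tendsto_pi_nhds]
  intro x y a b
  set δ : ℝ := if a = 0 ∧ b = 0 then 1 else 0
  have hval : ∀ m, dyadicCorr m (f m) x y a b =
      ∑ i, (c m i : ℝ) / 2 ^ m * ((A x a * A y b) i i).re +
        (1 - ∑ i, (c m i : ℝ) / 2 ^ m) * δ := by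
    intro m
    have h2 : ((2 : ℂ) ^ m)⁻¹ = (((2 : ℝ) ^ m)⁻¹ : ℝ) := by push_cast; rfl
    have h3 : (∑ i, (c m i : ℂ) * (A x a * A y b) i i + ((2 ^ m : ℂ) - ∑ i, (c m i : ℂ)) *
        if a = 0 ∧ b = 0 then 1 else 0).re = ∑ i, (c m i : ℝ) * ((A x a * A y b) i i).re +
        ((2 ^ m : ℝ) - ∑ i, (c m i : ℝ)) * δ := by
      have h4 : ((2 ^ m : ℂ) - ∑ i, (c m i : ℂ)) * (if a = 0 ∧ b = 0 then 1 else 0) =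
          ((((2 ^ m : ℝ) - ∑ i, (c m i : ℝ)) * δ : ℝ) : ℂ) := by
        push_cast; simp only [δ]; split_ifs <;> simp
      rw [h4, Complex.add_re, Complex.ofReal_re, Complex.re_sum]
      congr 1
      refine Finset.sum_congr rfl fun i _ => ?_
      rw [← Complex.ofReal_natCast, Complex.re_ofReal_mul]
    rw [dyadicCorr, dyadicTrace_apply, hftr, h2, Complex.re_ofReal_mul, h3, mul_add,
      Finset.mul_sum, ← mul_assoc, mul_sub, inv_mul_cancel₀ (by positivity), Finset.mul_sum]
    congr 1
    · exact Finset.sum_congr rfl fun i _ => by ring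
    · congr 2
      exact Finset.sum_congr rfl fun i _ => by ring
  have hpval : p x y a b = ∑ i, lam i * ((A x a * A y b) i i).re + (1 - ∑ i, lam i) * δ := by
    have := congrArg Complex.re (hp x y a b)
    rw [Complex.ofReal_re] at this
    rw [this, hlam1, sub_self, zero_mul, add_zero, Matrix.trace, Complex.re_sum]
    refine Finset.sum_congr rfl fun i _ => ?_
    rw [diag_apply, mul_diagonal, mul_comm, Complex.re_ofReal_mul]
  simp only [hval]
  rw [hpval]
  exact (tendsto_finsetSum _ fun i _ => (hlim i).mul_const _).add
    ((tendsto_const_nhds.sub (tendsto_finsetSum _ fun i _ => hlim i)).mul_const _)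

end Amplification

section SynchronousQuantum

open Matrix
open scoped ComplexOrder

variable {ι κ : Type*} [Fintype ι] [Fintype κ] [DecidableEq ι] [DecidableEq κ]

/-- If the correlation of two POVMs in the state of coefficient matrix `X` vanishes off the
diagonal, then `A a * X = X * B a`. -/
theorem mul_eq_mul_of_synchronous {n : ℕ} {A : Fin n → Matrix ι ι ℂ} {B : Fin n → Matrix κ κ ℂ}
    (hA : ∀ a, (A a).PosSemidef) (hA1 : ∑ a, A a = 1)
    (hB : ∀ a, (B a).PosSemidef) (hB1 : ∑ a, B a = 1) {X : Matrix ι κ ℂ}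
    (h : ∀ a b, a ≠ b → (Xᴴ * A a * X * B b).trace = 0) (a : Fin n) :
    A a * X = X * B a ∧ A a * A a * X = A a * X := by
  have h0 : ∀ a b, a ≠ b → A a * X * B b = 0 := fun a b hab =>
    (hA a).mul_mul_eq_zero_of_trace (hB b) X (h a b hab)
  have hr : ∀ a, A a * X = A a * X * B a := fun a => by
    calc A a * X = A a * X * ∑ b, B b := by rw [hB1, Matrix.mul_one]
      _ = A a * X * B a := by
        rw [Matrix.mul_sum]
        exact Finset.sum_eq_single a (fun b _ hb => h0 a b hb.symm) (by simp)
  have hl : ∀ a, X * B a = A a * X * B a := fun a => by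
    calc X * B a = (∑ b, A b) * (X * B a) := by rw [hA1, Matrix.one_mul]
      _ = A a * X * B a := by
        rw [Matrix.sum_mul, Finset.sum_eq_single a (fun b _ hb => by
          rw [← Matrix.mul_assoc, h0 b a hb]) (by simp), Matrix.mul_assoc]
  have heq : ∀ a, A a * X = X * B a := fun a => (hr a).trans (hl a).symm
  refine ⟨heq a, ?_⟩
  rw [Matrix.mul_assoc, heq, ← Matrix.mul_assoc, ← hr, heq]

/-- Synchronous correlations `Tr(X* A^x_a X B^y_b)` are limits of dyadic correlations: the density
matrix `X X*` commutes with the `A^x_a`, and conjugation by a unitary makes it diagonal. -/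
theorem mem_closure_dyadicCorrSet_of_matrix {k n : ℕ} [NeZero n]
    {A : Fin k → Fin n → Matrix ι ι ℂ} {B : Fin k → Fin n → Matrix κ κ ℂ} {X : Matrix ι κ ℂ}
    (hA : ∀ x a, (A x a).PosSemidef) (hA1 : ∀ x, ∑ a, A x a = 1)
    (hB : ∀ x a, (B x a).PosSemidef) (hB1 : ∀ x, ∑ a, B x a = 1)
    (hX : (Xᴴ * X).trace = 1) {p : Corr k n} (hs : IsSynchronous p)
    (hp : ∀ x y a b, (p x y a b : ℂ) = (Xᴴ * A x a * X * B y b).trace) :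
    p ∈ closure (dyadicCorrSet k n) := by
  have hAX := fun x a => (mul_eq_mul_of_synchronous (hA x) (hA1 x) (hB x) (hB1 x)
    (fun a b hab => by rw [← hp, hs x a b hab, Complex.ofReal_zero]) a)
  have hρ : (X * Xᴴ).PosSemidef := posSemidef_self_mul_conjTranspose X
  have hcomm : ∀ x a, A x a * (X * Xᴴ) = X * Xᴴ * A x a := fun x a => by
    have h2 := congrArg conjTranspose (hAX x a).1
    rw [conjTranspose_mul, conjTranspose_mul, (hA x a).1.eq, (hB x a).1.eq] at h2
    rw [← Matrix.mul_assoc, (hAX x a).1, Matrix.mul_assoc, ← h2, Matrix.mul_assoc]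
  obtain ⟨U, hU, hU', hd⟩ := hρ.1.exists_unitary_diagonal
  have hmul : ∀ M N : Matrix ι ι ℂ, Uᴴ * M * U * (Uᴴ * N * U) = Uᴴ * (M * N) * U := by
    intro M N
    calc Uᴴ * M * U * (Uᴴ * N * U) = Uᴴ * M * (U * Uᴴ) * N * U := by simp only [Matrix.mul_assoc]
      _ = _ := by rw [hU', Matrix.mul_one]; simp only [Matrix.mul_assoc]
  have htr : ∀ M : Matrix ι ι ℂ, (Uᴴ * M * U).trace = M.trace := fun M => by
    rw [trace_mul_comm, ← Matrix.mul_assoc, hU', Matrix.one_mul]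
  refine mem_closure_dyadicCorrSet_of_diagonal (A := fun x a => Uᴴ * A x a * U)
    (lam := hρ.1.eigenvalues) (fun x a => ((hA x a).conjTranspose_mul_mul_same U).1) (fun x => ?_)
    hρ.eigenvalues_nonneg ?_ (fun x a => ?_) (fun x a => ?_) (fun x y a b => ?_)
  · rw [← Matrix.sum_mul, ← Matrix.mul_sum, hA1, Matrix.mul_one, hU]
  · have h : (X * Xᴴ).trace = 1 := by rw [trace_mul_comm, hX]
    rw [← htr, hd, trace_diagonal] at h
    exact_mod_cast h
  · rw [← hd, hmul, hmul, hcomm]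
  · rw [← hd, hmul, hmul, hmul, ← Matrix.mul_assoc (A x a * A x a), (hAX x a).2,
      Matrix.mul_assoc (A x a)]
  · rw [← hd, hmul, hmul, htr, hp, Matrix.mul_assoc (Xᴴ * A x a), ← (hAX y b).1, Matrix.mul_assoc,
      trace_mul_comm]
    simp only [Matrix.mul_assoc]

theorem syncQuantumCorr_subset_closure (k n : ℕ) [NeZero n] :
    syncQuantumCorr k n ⊆ closure (dyadicCorrSet k n) := by
  rintro p ⟨⟨HA, HB, _, _, _, _, _, _, A, B, ξ, hA, hB, hξ, hp⟩, hs⟩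
  let u := stdOrthonormalBasis ℂ HA
  let v := stdOrthonormalBasis ℂ HB
  obtain ⟨X, hX⟩ : ∃ X, matrixVec u v X = ξ := by
    refine ⟨Matrix.of fun i j => (u.toBasis.tensorProduct v.toBasis).repr ξ (i, j), ?_⟩
    refine Eq.trans ?_ ((u.toBasis.tensorProduct v.toBasis).sum_repr ξ)
    rw [Fintype.sum_prod_type]
    simp only [matrixVec, of_apply, Module.Basis.tensorProduct_apply,
      OrthonormalBasis.coe_toBasis]
  have hu : ∀ C : HA →ₗ[ℂ] HA, (Matrix.of fun i j => inner ℂ (u i) (C (u j))) =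
      LinearMap.toMatrixOrthonormal u C := fun C => by
    ext i j; rw [LinearMap.toMatrixOrthonormal_apply_apply]; rfl
  have hv : ∀ C : HB →ₗ[ℂ] HB, (Matrix.of fun i j => inner ℂ (v i) (C (v j))) =
      LinearMap.toMatrixOrthonormal v C := fun C => by
    ext i j; rw [LinearMap.toMatrixOrthonormal_apply_apply]; rfl
  have hinner : ∀ C D, inner ℂ ξ (TensorProduct.map C D ξ) =
      (Xᴴ * LinearMap.toMatrixOrthonormal u C * X *
        (LinearMap.toMatrixOrthonormal v D)ᵀ).trace := fun C D => by
    rw [← hX, inner_map_matrixVec, hu, hv]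
  refine mem_closure_dyadicCorrSet_of_matrix (X := X)
    (A := fun x a => LinearMap.toMatrixOrthonormal u (A x a))
    (B := fun y b => (LinearMap.toMatrixOrthonormal v (B y b))ᵀ)
    (fun x a => (LinearMap.posSemidef_toMatrix_iff u).2 ((hA x).1 a)) (fun x => ?_)
    (fun y b => ((LinearMap.posSemidef_toMatrix_iff v).2 ((hB y).1 b)).transpose) (fun y => ?_)
    ?_ hs (fun x y a b => by rw [hp, hinner])
  · rw [← map_sum, (hA x).2, map_one]
  · rw [← transpose_sum, ← map_sum, (hB y).2, map_one, transpose_one]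
  · have h := hinner LinearMap.id LinearMap.id
    rw [TensorProduct.map_id, LinearMap.id_apply] at h
    have h1 : inner ℂ ξ ξ = (1 : ℂ) := by
      refine (inner_self_eq_norm_sq_to_K (𝕜 := ℂ) ξ).trans ?_
      rw [hξ]; simp
    have h2 : LinearMap.toMatrixOrthonormal u LinearMap.id = 1 := map_one _
    have h3 : LinearMap.toMatrixOrthonormal v LinearMap.id = 1 := map_one _
    rw [h1, h2, h3, transpose_one, Matrix.mul_one, Matrix.mul_one] at h
    exact h.symm

end SynchronousQuantum

/-! ### Conditional expectations onto the matrix algebras -/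

section GNSVectors

namespace DyadicAlg

theorem norm_star_eq (a : DyadicAlg) : ‖star a‖ = ‖a‖ := by
  rw [← sq_eq_sq₀ (norm_nonneg _) (norm_nonneg _), ← inner_self_eq_norm_sq (𝕜 := ℂ),
    ← inner_self_eq_norm_sq (𝕜 := ℂ), inner_def, inner_def, star_star, trace_mul_comm]

/-- Right multiplication by `b`, as a bounded operator for the 2-norm. -/
def rightMul (b : DyadicAlg) : DyadicAlg →L[ℂ] DyadicAlg :=
  (LinearMap.mulRight ℂ b).mkContinuousOfExistsBound (by
    obtain ⟨C, hC⟩ := exists_norm_mul_le (star b)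
    refine ⟨C, fun a => ?_⟩
    rw [LinearMap.mulRight_apply, ← norm_star_eq, star_mul, ← norm_star_eq a]
    exact hC _)

@[simp]
theorem rightMul_apply (b a : DyadicAlg) : rightMul b a = a * b := rfl

theorem completion_rightMul_coe (b a : DyadicAlg) :
    (rightMul b).completion (a : GNS) = ((a * b : DyadicAlg) : GNS) := by simp

theorem completion_rightMul_mem_centralizer (b : DyadicAlg) :
    (rightMul b).completion ∈ Set.centralizer (Set.range gns) := by
  rintro _ ⟨a, rfl⟩
  ext c
  induction c using UniformSpace.Completion.induction_on with
  | hp => apply isClosed_eq <;> fun_prop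
  | ih c => simp [mul_assoc]

theorem inner_completion_rightMul_star (b : DyadicAlg) (v w : GNS) :
    inner ℂ ((rightMul (star b)).completion v) w = inner ℂ v ((rightMul b).completion w) := by
  induction v, w using UniformSpace.Completion.induction_on₂ with
  | hp => apply isClosed_eq <;> fun_prop
  | ih v w =>
    simp only [completion_rightMul_coe, UniformSpace.Completion.inner_coe, inner_def, star_mul,
      star_star]
    rw [mul_assoc, trace_mul_comm, mul_assoc]

/-- Elements of the factor commute with right multiplications, so that `⟨b c*, u Ω⟩ = ⟨b, u c⟩`.
With `b = c` this carries positivity of `u` over to the functional `⟨·, u Ω⟩` on matrices. -/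
theorem inner_mul_star_apply_one {u : GNS →L[ℂ] GNS} (hu : u ∈ HyperfiniteR) (b c : DyadicAlg) :
    inner ℂ ((b * star c : DyadicAlg) : GNS) (u ((1 : DyadicAlg) : GNS)) =
      inner ℂ (b : GNS) (u (c : GNS)) := by
  rw [← SetLike.mem_coe, coe_hyperfiniteR] at hu
  have h := congrArg (fun z : GNS →L[ℂ] GNS => z ((1 : DyadicAlg) : GNS))
    (hu _ (completion_rightMul_mem_centralizer c))
  simp only [mul_apply_eq_comp, completion_rightMul_coe, one_mul] at h
  rw [← completion_rightMul_coe, inner_completion_rightMul_star, h]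

theorem inner_of_of (m : ℕ) (A B : DyadicMatrix m) :
    inner ℂ (of m A : GNS) (of m B : GNS) = dyadicTrace m (star A * B) := by
  rw [UniformSpace.Completion.inner_coe, inner_def, ← map_star, ← map_mul, trace_of]

open scoped ComplexOrder in
theorem of_injective (m : ℕ) : Function.Injective (of m) := by
  rw [injective_iff_map_eq_zero]
  intro A hA
  have h := inner_of_of m A A
  rw [hA, UniformSpace.Completion.coe_zero, inner_zero_left, dyadicTrace_apply] at h
  refine Matrix.trace_conjTranspose_mul_self_eq_zero_iff.1 ?_
  simpa [Matrix.star_eq_conjTranspose] using h.symm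

/-- The map `A ↦ A Ω` from the matrices of size `2 ^ m` to the GNS space. -/
def toGNS (m : ℕ) : DyadicMatrix m →ₗ[ℂ] GNS :=
  (UniformSpace.Completion.toComplₗᵢ (𝕜 := ℂ) (E := DyadicAlg)).toLinearMap ∘ₗ
    (of m).toAlgHom.toLinearMap

theorem toGNS_apply (m : ℕ) (A : DyadicMatrix m) : toGNS m A = (of m A : GNS) := rfl

theorem norm_toGNS_sq (m : ℕ) (A : DyadicMatrix m) :
    ‖toGNS m A‖ ^ 2 = ((2 : ℝ) ^ m)⁻¹ * (A.conjTranspose * A).trace.re := by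
  have h : ((2 : ℂ) ^ m)⁻¹ = (((2 : ℝ) ^ m)⁻¹ : ℝ) := by push_cast; rfl
  rw [← inner_self_eq_norm_sq (𝕜 := ℂ), toGNS_apply, inner_of_of, dyadicTrace_apply, h]
  exact Complex.re_ofReal_mul _ _

theorem re_inner_one_toGNS (m : ℕ) (A : DyadicMatrix m) :
    (inner ℂ ((1 : DyadicAlg) : GNS) (toGNS m A)).re = ((2 : ℝ) ^ m)⁻¹ * A.trace.re := by
  have h : ((2 : ℂ) ^ m)⁻¹ = (((2 : ℝ) ^ m)⁻¹ : ℝ) := by push_cast; rfl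
  rw [toGNS_apply, ← map_one (of m), inner_of_of, star_one, one_mul, dyadicTrace_apply, h]
  exact Complex.re_ofReal_mul _ _

/-- The finite-dimensional subspace `M_{2 ^ m} Ω` of the GNS space. -/
def matrixSubspace (m : ℕ) : Submodule ℂ GNS := LinearMap.range (toGNS m)

instance (m : ℕ) : FiniteDimensional ℂ (matrixSubspace m) := by
  unfold matrixSubspace; infer_instance

theorem mem_matrixSubspace {m : ℕ} {w : GNS} :
    w ∈ matrixSubspace m ↔ ∃ A : DyadicMatrix m, (of m A : GNS) = w := Iff.rfl

theorem monotone_matrixSubspace : Monotone matrixSubspace := by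
  rintro i j hij w ⟨A, rfl⟩
  exact mem_matrixSubspace.2 ⟨dyadicBond i j hij A, by rw [of_bond]; rfl⟩

theorem topologicalClosure_iSup_matrixSubspace :
    ⊤ ≤ (⨆ m, matrixSubspace m).topologicalClosure := by
  rintro w -
  induction w using UniformSpace.Completion.induction_on with
  | hp => exact (⨆ m, matrixSubspace m).isClosed_topologicalClosure
  | ih a =>
    obtain ⟨m, A, rfl⟩ := exists_of a
    exact Submodule.le_topologicalClosure _
      (Submodule.mem_iSup_of_mem m (mem_matrixSubspace.2 ⟨A, rfl⟩))

/-- The matrix whose class is the orthogonal projection of `w` onto `M_{2 ^ m} Ω`. For `w = u Ω`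
with `u` in the factor, it is the trace-preserving conditional expectation of `u`. -/
def matrixPart (m : ℕ) (w : GNS) : DyadicMatrix m :=
  (mem_matrixSubspace.1 ((matrixSubspace m).starProjection_apply_mem w)).choose

theorem of_matrixPart (m : ℕ) (w : GNS) :
    (of m (matrixPart m w) : GNS) = (matrixSubspace m).starProjection w :=
  (mem_matrixSubspace.1 ((matrixSubspace m).starProjection_apply_mem w)).choose_spec

theorem tendsto_matrixPart (w : GNS) :
    Filter.Tendsto (fun m => (of m (matrixPart m w) : GNS)) Filter.atTop (nhds w) := by
  simp only [of_matrixPart]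
  exact Submodule.starProjection_tendsto_self _ monotone_matrixSubspace w
    topologicalClosure_iSup_matrixSubspace

theorem dyadicTrace_star_mul_matrixPart {m : ℕ} (B : DyadicMatrix m) (w : GNS) :
    dyadicTrace m (star B * matrixPart m w) = inner ℂ (of m B : GNS) w := by
  rw [← inner_of_of, of_matrixPart, ← Submodule.inner_starProjection_left_eq_right,
    Submodule.starProjection_eq_self_iff.2 (mem_matrixSubspace.2 ⟨B, rfl⟩)]

open scoped ComplexOrder in
open Matrix in
theorem posSemidef_matrixPart {u : GNS →L[ℂ] GNS} (hu : u ∈ HyperfiniteR)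
    (hpos : ∀ w, 0 ≤ inner ℂ w (u w)) (m : ℕ) :
    (matrixPart m (u ((1 : DyadicAlg) : GNS))).PosSemidef := by
  set T := matrixPart m (u ((1 : DyadicAlg) : GNS)) with hT
  have hx : ∀ x : Fin (2 ^ m) → ℂ, 0 ≤ star x ⬝ᵥ (T *ᵥ x) := by
    intro x
    obtain ⟨C, hC⟩ := (posSemidef_vecMulVec_self_star x).exists_eq_conjTranspose_mul_self
    have h1 : star x ⬝ᵥ (T *ᵥ x) = (2 : ℂ) ^ m * dyadicTrace m (star (Cᴴ * C) * T) := by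
      have h2 : star (Cᴴ * C) = Cᴴ * C := by simp [star_eq_conjTranspose]
      rw [dyadicTrace_apply, mul_inv_cancel_left₀ (by positivity), h2, ← hC, Matrix.trace_mul_comm,
        mul_vecMulVec, trace_vecMulVec, dotProduct_comm]
    rw [h1, hT, dyadicTrace_star_mul_matrixPart, map_mul]
    have h3 := inner_mul_star_apply_one hu (of m Cᴴ) (of m Cᴴ)
    rw [← map_star, star_eq_conjTranspose, conjTranspose_conjTranspose] at h3
    rw [h3]
    exact mul_nonneg (by positivity) (hpos _)
  rw [← isPositive_toEuclideanLin_iff, LinearMap.isPositive_iff_complex]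
  intro x
  have h := hx x
  have h1 : inner ℂ (toEuclideanLin T x) x = star (star (x : Fin (2 ^ m) → ℂ) ⬝ᵥ (T *ᵥ x)) := by
    rw [EuclideanSpace.inner_eq_star_dotProduct, dotProduct_star, dotProduct_comm]
    rfl
  have h2 := Complex.nonneg_iff.1 h
  rw [h1]
  refine ⟨Complex.ext (by simp) (by simpa using h2.2.symm), by simpa using h2.1⟩

theorem sum_matrixPart_eq_one {n : ℕ} {w : Fin n → GNS}
    (hw : ∑ a, w a = ((1 : DyadicAlg) : GNS)) (m : ℕ) : ∑ a, matrixPart m (w a) = 1 := by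
  apply of_injective m
  apply UniformSpace.Completion.coe_injective
  have h1 : ((of m (∑ a, matrixPart m (w a)) : DyadicAlg) : GNS) =
      ∑ a, (of m (matrixPart m (w a)) : GNS) := by
    rw [map_sum]
    exact map_sum (UniformSpace.Completion.toComplₗᵢ (𝕜 := ℂ) (E := DyadicAlg)) _ _
  rw [h1]
  simp only [of_matrixPart]
  rw [← map_sum, hw, map_one, Submodule.starProjection_eq_self_iff]
  exact mem_matrixSubspace.2 ⟨1, by rw [map_one]⟩

end DyadicAlg

end GNSVectors

/-! ### Correlations of the hyperfinite factor as limits of dyadic ones -/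

section HyperfiniteCorrelations

open DyadicAlg Filter Topology
open scoped ComplexOrder

/-- The class `Ω` of `1` in the GNS space. -/
local notation "Ω" => ((1 : DyadicAlg) : DyadicAlg.GNS)

theorem inner_apply_apply_of_isStarProjection {e f : GNS →L[ℂ] GNS} (he : IsStarProjection e)
    (v w : GNS) : inner ℂ (e v) (f w) = inner ℂ v ((e * f) w) := by
  rw [mul_apply_eq_comp, ← ContinuousLinearMap.adjoint_inner_right,
    ← ContinuousLinearMap.star_eq_adjoint, he.isSelfAdjoint.star_eq]

/-- The variance `⟨Ω, ∑ b² v_b⟩ - ‖∑ b v_b‖²` of a family of vectors. For `v_b = T_b Ω` with a POVM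
`T` it is the normalized trace of the operator `∑ b² T_b - (∑ b T_b)²`. -/
def vectorVariance {n : ℕ} (v : Fin n → GNS) : ℝ :=
  (∑ b : Fin n, ((b : ℕ) : ℝ) ^ 2 * (inner ℂ Ω (v b)).re) - ‖∑ b : Fin n, ((b : ℕ) : ℂ) • v b‖ ^ 2

theorem continuous_vectorVariance {n : ℕ} :
    Continuous (vectorVariance : (Fin n → GNS) → ℝ) := by
  have h1 : ∀ b : Fin n, Continuous fun v : Fin n → GNS => (inner ℂ Ω (v b)).re := fun b =>
    Complex.continuous_re.comp (continuous_const.inner (continuous_apply b))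
  have h2 : Continuous fun v : Fin n → GNS => ∑ b : Fin n, ((b : ℕ) : ℂ) • v b :=
    continuous_finsetSum _ fun b _ => (continuous_const_smul _).comp (continuous_apply b)
  exact (continuous_finsetSum _ fun b _ => (h1 b).const_mul _).sub (h2.norm.pow 2)

theorem vectorVariance_pvm {n : ℕ} {e : Fin n → (GNS →L[ℂ] GNS)}
    (he : e ∈ PVM n (GNS →L[ℂ] GNS)) : vectorVariance (fun b => e b Ω) = 0 := by
  rw [vectorVariance, sub_eq_zero, ← inner_self_eq_norm_sq (𝕜 := ℂ), sum_inner, map_sum]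
  refine Finset.sum_congr rfl fun b _ => ?_
  rw [inner_sum, Finset.sum_eq_single b]
  · rw [inner_smul_left, inner_smul_right, inner_apply_apply_of_isStarProjection (he.1 b),
      (he.1 b).isIdempotentElem.eq, ← mul_assoc]
    simp [sq]
  · intro c _ hcb
    rw [inner_smul_left, inner_smul_right, inner_apply_apply_of_isStarProjection (he.1 b),
      mul_eq_zero_of_isStarProjection_of_sum_eq_one he hcb.symm]
    simp
  · simp

/-- The rounding of POVMs, in the GNS space. -/
theorem exists_pvm_norm_sq_le_vectorVariance {n m : ℕ} [NeZero n] {T : Fin n → DyadicMatrix m}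
    (hT : ∀ a, (T a).PosSemidef) (hT1 : ∑ a, T a = 1) :
    ∃ P ∈ PVM n (DyadicMatrix m), ∀ a,
      ‖toGNS m (P a) - toGNS m (T a)‖ ^ 2 ≤ 4 * vectorVariance fun b => toGNS m (T b) := by
  obtain ⟨P, hP, hle⟩ := exists_pvm_near_povm hT hT1
  refine ⟨P, hP, fun a => ?_⟩
  have h1 : ∑ b : Fin n, ((b : ℕ) : ℂ) • toGNS m (T b) =
      toGNS m (∑ b : Fin n, ((b : ℕ) : ℂ) • T b) := by
    rw [map_sum]; simp only [map_smul]
  rw [vectorVariance, ← map_sub, norm_toGNS_sq, h1, norm_toGNS_sq]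
  simp only [re_inner_one_toGNS]
  refine (mul_le_mul_of_nonneg_left (hle a) (by positivity)).trans_eq ?_
  rw [mul_left_comm, mul_sub, Finset.mul_sum]
  simp only [mul_left_comm]

/-- A PVM in the hyperfinite factor is approximated in 2-norm by PVMs of dyadic matrices: its
conditional expectations are POVMs whose variance tends to that of the given PVM, which
vanishes. -/
theorem exists_dyadic_pvm_tendsto {n : ℕ} [NeZero n] {e : Fin n → (GNS →L[ℂ] GNS)}
    (heR : ∀ a, e a ∈ HyperfiniteR) (he : e ∈ PVM n (GNS →L[ℂ] GNS)) :
    ∃ P : (m : ℕ) → Fin n → DyadicMatrix m, (∀ m, P m ∈ PVM n (DyadicMatrix m)) ∧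
      ∀ a, Tendsto (fun m => (of m (P m a) : GNS)) atTop (𝓝 (e a Ω)) := by
  set T : (m : ℕ) → Fin n → DyadicMatrix m := fun m a => matrixPart m (e a Ω)
  have hTpos : ∀ m a, (T m a).PosSemidef := fun m a =>
    posSemidef_matrixPart (heR a) (fun v => by
      rw [← (he.1 a).isIdempotentElem.eq, ← inner_apply_apply_of_isStarProjection (he.1 a),
        inner_self_eq_norm_sq_to_K, ← RCLike.ofReal_pow]
      exact Complex.zero_le_real.2 (sq_nonneg _)) m
  have hT1 : ∀ m, ∑ a, T m a = 1 := fun m => sum_matrixPart_eq_one (by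
    rw [← _root_.sum_apply, he.2, one_apply_eq_self]) m
  choose P hP hle using fun m => exists_pvm_norm_sq_le_vectorVariance (hTpos m) (hT1 m)
  refine ⟨P, hP, fun a => ?_⟩
  have hTlim : ∀ b, Tendsto (fun m => toGNS m (T m b)) atTop (𝓝 (e b Ω)) := fun b =>
    tendsto_matrixPart _
  have hVlim : Tendsto (fun m => 4 * vectorVariance fun b => toGNS m (T m b)) atTop (𝓝 0) := by
    have h := ((continuous_vectorVariance.tendsto _).comp (tendsto_pi_nhds.2 hTlim)).const_mul 4
    rwa [vectorVariance_pvm he, mul_zero] at h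
  have hdiff : Tendsto (fun m => toGNS m (P m a) - toGNS m (T m a)) atTop (𝓝 0) := by
    rw [tendsto_zero_iff_norm_tendsto_zero]
    have h := (squeeze_zero (fun m => sq_nonneg _) (fun m => hle m a) hVlim).sqrt
    simpa only [Real.sqrt_sq (norm_nonneg _), Real.sqrt_zero] using h
  have h := hdiff.add (hTlim a)
  simp only [sub_add_cancel, zero_add] at h
  exact h

theorem corrR_subset_closure (k n : ℕ) [NeZero n] : corrR k n ⊆ closure (dyadicCorrSet k n) := by
  rintro p ⟨-, e, he, hp⟩
  have hPVM : ∀ x, (fun a => (e x a : GNS →L[ℂ] GNS)) ∈ PVM n (GNS →L[ℂ] GNS) := fun x =>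
    ⟨fun a => ⟨congrArg Subtype.val ((he x).1 a).isIdempotentElem,
      congrArg Subtype.val ((he x).1 a).isSelfAdjoint⟩, by
      refine Eq.trans ?_ (congrArg Subtype.val (he x).2)
      exact (map_sum (HyperfiniteR.toStarSubalgebra.subtype) _ _).symm⟩
  choose P hP hlim using fun x => exists_dyadic_pvm_tendsto (fun a => (e x a).2) (hPVM x)
  refine mem_closure_of_tendsto (f := fun m => dyadicCorr m (fun x a => P x m a)) (b := atTop) ?_
    (Eventually.of_forall fun m => ⟨m, _, fun x => hP x m, rfl⟩)
  simp only [tendsto_pi_nhds]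
  intro x y a b
  have h1 : p x y a b = (inner ℂ ((e x a : GNS →L[ℂ] GNS) Ω) ((e y b : GNS →L[ℂ] GNS) Ω)).re := by
    rw [← Complex.ofReal_re (p x y a b), hp,
      inner_apply_apply_of_isStarProjection ((hPVM x).1 a)]
    rfl
  have h2 : ∀ m, dyadicCorr m (fun x a => P x m a) x y a b =
      (inner ℂ (of m (P x m a) : GNS) (of m (P y m b) : GNS)).re := fun m => by
    rw [inner_of_of, ((hP x m).1 a).isSelfAdjoint.star_eq]; rfl
  simp only [h2]
  rw [h1]
  exact (Complex.continuous_re.tendsto _).comp ((hlim x a).inner (hlim y b))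

end HyperfiniteCorrelations

end

theorem mainTheorem10 (k n : ℕ) (hk : 2 ≤ k) (hn : 2 ≤ n) :
    closure (syncQuantumCorr k n) = closure (corrR k n) := by
  have : NeZero n := ⟨by omega⟩
  have h1 : closure (syncQuantumCorr k n) = closure (dyadicCorrSet k n) :=
    (closure_minimal (syncQuantumCorr_subset_closure k n) isClosed_closure).antisymm
      (closure_mono (dyadicCorrSet_subset_syncQuantumCorr k n))
  have h2 : closure (corrR k n) = closure (dyadicCorrSet k n) :=
    (closure_minimal (corrR_subset_closure k n) isClosed_closure).antisymm
      (closure_mono (dyadicCorrSet_subset_corrR k n))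
  rw [h1, h2]
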